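/- **Theorem 2.10 (Single-overlap property).** *Model.* Let $\mathcal H$ be the set of non-empty finite simple connected graphs, each isomorphism class being represented by one (arbitrary but fixed) graph $H$ with vertex set $\{1,\dots,|H|\}$. For each $n\in\mathbb N$ let $N_n,M_n$ be numbers of individuals and of communities, let $d^{l}_v\ge 1$ ($v\in[N_n]$) be integers and $\mathrm{Com}_a\in\mathcal H$ ($a\in[M_n]$) be community graphs, with sizes $d^{r}_a=|\mathrm{Com}_a|$, such that $\sum_{v} d^{l}_v=\sum_{a} d^{r}_a$. Assume $N_n\to\infty$. Let $\omega_n$ be a uniformly random bijection between the membership tokens $(v,i)$, $v\in[N_n]$, $i\in[d^l_v]$, and the community roles $(a,j)$, $a\in[M_n]$, $j\in[d^r_a]$. The individual $v$ *is part of* the community $a$ if some token $(v,i)$ is matched with some role $(a,j)$. For $a\ne b$ let $\mathcal O(a,b)$ be the number of individuals that are part of both $a$ and $b$; let $\mathcal N(a)=\{b\neq a:\mathcal O(a,b)\ge1\}$ and, for $k\geq 1$, let $\mathcal L_k$ be the set of unordered pairs $\{a,b\}$, $a\ne b$, with $\mathcal O(a,b)\ge k$. *Assumptions.* Let $V^l_n$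 and $V^r_n$ be a uniform individual and a uniform community, independent of $\omega_n$, and let $D^l_n=d^l_{V^l_n}$, $D^r_n=d^r_{V^r_n}$. Suppose that there are probability mass functions $p$ on the positive integers and $\mu$ on $\mathcal H$ such that, with $D^l\sim p$ and with $D^r$ the size of a random graph with law $\mu$, as $n\to\infty$: $\mathbb P(D^l_n=k)\to p_k$ for every $k$; $\mathbb E[D^l]<\infty$ and $\mathbb E[D^l_n]\to\mathbb E[D^l]$; $\mathbb P(\mathrm{Com}_{V^r_n}=H)\to\mu_H$ for every $H\in\mathcal H$; $\mathbb E[D^r]<\infty$ and $\mathbb E[D^r_n]\to\mathbb E[D^r]$. *Conclusions.* As $n\to\infty$: (i) $\mathbb P\bigl(\exists\{a,b\}\in\mathcal L_2:\ V^l_n \text{ is part of } a \text{ and of } b\,\big|\,\omega_n\bigr)\to0$ in probability. (ii) $\mathbb P\bigl(\exists b\in\mathcal N(V^r_n):\ \mathcal O(V^r_n,b)\ge2\,\big|\,\omega_n\bigr)\to0$ in probability. (iii) If moreover $\mathbb E[(D^l_n)^2]\to\mathbb E[(D^l)^2]<\infty$, then for a pair $\{A_n,B_n\}$ chosen uniformly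 from $\mathcal L_1$, $$\mathbb P\bigl(\mathcal O(A_n,B_n)\ge2\,\big|\,\omega_n\bigr)=\frac{|\mathcal L_2|}{|\mathcal L_1|}\to0\quad\text{in probability,}$$ where the conditional probability and the ratio are read as $0$ if $\mathcal L_1=\emptyset$. -/

import Mathlib

open MeasureTheory ProbabilityTheory Filter Topology

noncomputable section

namespace RIGC

/-- A finite simple graph with vertex labels `Fin k`, where `k` is its size. -/
abbrev LabeledGraph : Type := Σ k : ℕ, SimpleGraph (Fin k)

/-- `𝓗` is a set of possible community graphs: (non-empty) finite simple connected graphs, with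
exactly one labeled representative of every isomorphism class (the arbitrary fixed labeling). -/
structure IsCommunityClass (𝓗 : Set LabeledGraph) : Prop where
  connected : ∀ H ∈ 𝓗, H.2.Connected
  existsUnique_iso : ∀ (k : ℕ) (G : SimpleGraph (Fin k)), G.Connected →
    ∃! H : LabeledGraph, H ∈ 𝓗 ∧ Nonempty (G ≃g H.2)

/-- Parameters `(dˡ, Com)` of a random intersection graph with communities: `N` individuals with
numbers of group memberships `ldeg v ≥ 1`, and `M` communities with community graphs `com a ∈ 𝓗`,
such that there are as many membership tokens as community roles. -/
structure Params (𝓗 : Set LabeledGraph) where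
  N : ℕ
  M : ℕ
  ldeg : Fin N → ℕ
  com : Fin M → 𝓗
  ldeg_pos : ∀ v, 1 ≤ ldeg v
  halfEdges_eq : ∑ v, ldeg v = ∑ a, (com a).1.1

namespace Params

variable {𝓗 : Set LabeledGraph} (P : Params 𝓗)

/-- The number of community roles of the community `a`: the size of its community graph. -/
def rdeg (a : Fin P.M) : ℕ := (P.com a).1.1

/-- Membership tokens `(v, i)`. -/
abbrev LHalfEdge : Type := Σ v : Fin P.N, Fin (P.ldeg v)

/-- Community roles `(a, l)`. -/
abbrev RHalfEdge : Type := Σ a : Fin P.M, Fin (P.rdeg a)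

/-- All bijections between the membership tokens and the community roles. -/
abbrev Matching : Type := P.LHalfEdge ≃ P.RHalfEdge

instance : MeasurableSpace P.Matching := ⊤

/-- The law of the uniform bipartite matching. -/
def matchingLaw : Measure P.Matching := uniformOn Set.univ

/-- The law of a uniform individual. -/
def individualLaw : Measure (Fin P.N) := uniformOn Set.univ

/-- The law of a uniform community. -/
def communityLaw : Measure (Fin P.M) := uniformOn Set.univ

/-- The proportion of individuals with exactly `k` group memberships. -/
def ldegFreq (k : ℕ) : ℝ := ({v : Fin P.N | P.ldeg v = k}.ncard : ℝ) / P.N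

/-- The proportion of communities whose community graph is `H`. -/
def comFreq (H : 𝓗) : ℝ := ({a : Fin P.M | P.com a = H}.ncard : ℝ) / P.M

/-- Mean number of group memberships of a uniform individual. -/
def ldegMean : ℝ := (∑ v, (P.ldeg v : ℝ)) / P.N

/-- Second moment of the number of group memberships of a uniform individual. -/
def ldegSecondMoment : ℝ := (∑ v, (P.ldeg v : ℝ) ^ 2) / P.N

/-- Mean size of a uniform community. -/
def rdegMean : ℝ := (∑ a, (P.rdeg a : ℝ)) / P.M

variable {P}

/-- The individual `v` takes the community role `j`. -/
def Takes (ω : P.Matching) (v : Fin P.N) (j : P.RHalfEdge) : Prop := (ω.symm j).1 = v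

/-- The individual `v` is part of the community `a`. -/
def IsPartOf (ω : P.Matching) (v : Fin P.N) (a : Fin P.M) : Prop :=
  ∃ l : Fin (P.rdeg a), Takes ω v ⟨a, l⟩

/-- The number of individuals that are part of both `a` and `b`. -/
def overlap (ω : P.Matching) (a b : Fin P.M) : ℕ :=
  {v : Fin P.N | IsPartOf ω v a ∧ IsPartOf ω v b}.ncard

/-- The communities overlapping with the community `a`. -/
def overlapNbrs (ω : P.Matching) (a : Fin P.M) : Set (Fin P.M) :=
  {b | b ≠ a ∧ 1 ≤ overlap ω a b}

/-- The unordered pairs of distinct communities that overlap in at least `k` individuals. -/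
def overlapPairs (ω : P.Matching) (k : ℕ) : Set (Sym2 (Fin P.M)) :=
  {e | ∃ a b : Fin P.M, e = s(a, b) ∧ a ≠ b ∧ k ≤ overlap ω a b}

/-- Probability, given the matching, that a uniform individual is part of two distinct communities
that overlap in at least two individuals. -/
def vertexOverlapProb (ω : P.Matching) : ℝ :=
  P.individualLaw.real
    {v | ∃ a b : Fin P.M, s(a, b) ∈ overlapPairs ω 2 ∧ IsPartOf ω v a ∧ IsPartOf ω v b}

/-- Probability, given the matching, that a uniform community overlaps with some other community in
at least two individuals. -/
def groupOverlapProb (ω : P.Matching) : ℝ :=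
  P.communityLaw.real {a | ∃ b ∈ overlapNbrs ω a, 2 ≤ overlap ω a b}

instance : MeasurableSpace (Sym2 (Fin P.M)) := ⊤

/-- Probability, given the matching, that a uniform pair `{A, B}` of overlapping communities
overlaps in at least two individuals (`0` if there is no overlapping pair). -/
def globalOverlapProb (ω : P.Matching) : ℝ :=
  (uniformOn (overlapPairs ω 1)).real
    {e | ∃ a b : Fin P.M, e = s(a, b) ∧ 2 ≤ overlap ω a b}

end Params

/-- The law of the size of a random community graph with law `μ`. -/
def sizeLaw {𝓗 : Set LabeledGraph} (μ : PMF 𝓗) : PMF ℕ := μ.map fun H => H.1.1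

/-- The conditions on the empirical distributions of a sequence of parameters, with limiting
laws `p` (for the number of memberships) and `μ` (for the community graph). -/
structure Converges {𝓗 : Set LabeledGraph} (P : ℕ → Params 𝓗) (p : PMF ℕ) (μ : PMF 𝓗) :
    Prop where
  ldeg_limit : ∀ k, Tendsto (fun n => (P n).ldegFreq k) atTop (𝓝 (p k).toReal)
  ldeg_mean_finite : Summable fun k : ℕ => (k : ℝ) * (p k).toReal
  ldeg_mean : Tendsto (fun n => (P n).ldegMean) atTop (𝓝 (∑' k : ℕ, (k : ℝ) * (p k).toReal))
  com_limit : ∀ H, Tendsto (fun n => (P n).comFreq H) atTop (𝓝 (μ H).toReal)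
  rdeg_mean_finite : Summable fun k : ℕ => (k : ℝ) * (sizeLaw μ k).toReal
  rdeg_mean : Tendsto (fun n => (P n).rdegMean) atTop
    (𝓝 (∑' k : ℕ, (k : ℝ) * (sizeLaw μ k).toReal))

/-- Convergence of the second moment of the number of memberships to a finite limit. -/
structure SecondMomentConverges {𝓗 : Set LabeledGraph} (P : ℕ → Params 𝓗) (p : PMF ℕ) :
    Prop where
  finite : Summable fun k : ℕ => (k : ℝ) ^ 2 * (p k).toReal
  limit : Tendsto (fun n => (P n).ldegSecondMoment) atTop
    (𝓝 (∑' k : ℕ, (k : ℝ) ^ 2 * (p k).toReal))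

/-- Convergence in probability to `0`, as `n → ∞`, of functions `X n` of the uniform bipartite
matchings with parameters `P n`. -/
def TendstoInProbZero {𝓗 : Set LabeledGraph} (P : ℕ → Params 𝓗)
    (X : ∀ n, (P n).Matching → ℝ) : Prop :=
  ∀ ε : ℝ, 0 < ε → Tendsto (fun n => (P n).matchingLaw.real {ω | ε < |X n ω|}) atTop (𝓝 0)

end RIGC

end

/-!
Two communities that overlap in two individuals form a 4-cycle in the bipartite graph of individuals
and communities whose edges are the pairs (membership token, role) matched by the uniform bijection
`ω`. All three claims follow from first-moment estimates on such 4-cycles, after truncation of the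
degrees. Everything is done for a uniform bijection `ω : X ≃ Y` of finite sets with maps `f : X → V`
(token to individual) and `g : Y → A` (role to community), where `h` is the number of elements of
`X` and of `Y`.

*Truncation.* Convergence of the empirical laws and of the means gives uniform integrability: tokens
of individuals with more than `L` tokens, and roles in communities with more than `K` roles, are a
small proportion of all `h` tokens or roles (`exists_eventually_tail_le`, `HasLightTails`).

*First moments.* A given injective `k`-tuple of tokens is sent to a given injective `k`-tuple of
roles with probability `1 / (h (h - 1) ⋯ (h - k + 1))` (`expect_card_filter_trans`).

*A uniform individual or community.* The individuals on a 4-cycle that involves a large individual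
or a large community are few for every `ω` (`card_cycleVertices_le`). A 4-cycle in which all degrees
are bounded is given by `O(h ^ 2)` choices of tokens and `O(h ^ 2)` choices of roles, and each choice
has probability of order `h ^ (-4)`, so the expected number of these cycles is bounded. As `h` is of
the order of the number of individuals, the proportion of individuals on a 4-cycle tends to zero.
The same applied to the inverse bijection handles communities.

*A uniform overlapping pair.* Let `D` be the number of ordered pairs of distinct tokens of the same
individual (`numPairs`). Up to an error of small mean relative to `D`, all these pairs join distinct
communities with at most `K` roles, and then at most `4 K ^ 2` of them give the same pair of
communities: so there are at least of the order of `D` overlapping pairs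
(`numPairs_le_of_overlaps`). The expected number of pairs overlapping twice is at most a small
multiple of `D` plus a term of order `D ^ 2 / h ^ 2` (`expect_card_le_of_fourCycles`), and `D` is
small compared with `h ^ 2` (`eventually_numPairs_le`). Comparing both with `D` rather than with `h`
covers the case that almost all individuals have a single token.
-/

noncomputable section

namespace RIGC

open Finset
open scoped BigOperators Classical

/-! ### Fibres and tuples -/

section Fibers

variable {X Y V A : Type*} [Fintype X] [Fintype Y]

/-- The number of elements in the fibre of `g` that contains `y`: for the map sending a role to its
community, the size of the community of `y`. -/
def fiberCard (g : Y → A) (y : Y) : ℕ := #{z | g z = g y}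

/-- The number of elements that lie in fibres of `g` with more than `K` elements. Elements are
counted, not fibres, so this is a tail of the size-biased fibre size. -/
def numLarge (g : Y → A) (K : ℕ) : ℕ := #{y | K < fiberCard g y}

theorem fiberCard_congr {g : Y → A} {y z : Y} (h : g y = g z) : fiberCard g y = fiberCard g z := by
  simp [fiberCard, h]

theorem card_smallPairs_le (g : Y → A) (K : ℕ) :
    #{z : Y × Y | g z.1 = g z.2 ∧ fiberCard g z.1 ≤ K} ≤ Fintype.card Y * K := by
  calc #{z : Y × Y | g z.1 = g z.2 ∧ fiberCard g z.1 ≤ K}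
      = ∑ y : Y, #{z ∈ ({z : Y × Y | g z.1 = g z.2 ∧ fiberCard g z.1 ≤ K} : Finset _) | z.1 = y} :=
        Finset.card_eq_sum_card_fiberwise (by simp)
    _ ≤ ∑ _y : Y, K := by
        refine Finset.sum_le_sum fun y _ => ?_
        by_cases hy : fiberCard g y ≤ K
        · refine le_trans ?_ hy
          refine Finset.card_le_card_of_injOn Prod.snd ?_ ?_
          · rintro ⟨a, b⟩ hz
            simp only [coe_filter, mem_filter, mem_univ, true_and, Set.mem_ofPred_eq] at hz ⊢
            rw [← hz.1.1, hz.2]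
          · rintro ⟨a, b⟩ hz ⟨a', b'⟩ hz' hb
            simp only [coe_filter, mem_filter, mem_univ, true_and, Set.mem_ofPred_eq] at hz hz' hb
            rw [hz.2, hz'.2, hb]
        · rw [Finset.card_eq_zero.2]
          · exact Nat.zero_le _
          · refine Finset.filter_eq_empty_iff.2 ?_
            rintro ⟨a, b⟩ hz rfl
            simp only [mem_filter] at hz
            exact hy hz.2.2
    _ = _ := by simp

/-- The permutation `i` says which coordinates of a 4-tuple are paired up. -/
theorem card_embedding_four_le (i : Fin 4 → Fin 4) (hi : Function.Injective i)
    (q : (Fin 4 ↪ Y) → Prop) [DecidablePred q] (S T : Finset (Y × Y))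
    (hq : ∀ y, q y → (y (i 0), y (i 1)) ∈ S ∧ (y (i 2), y (i 3)) ∈ T) :
    #{y | q y} ≤ #S * #T := by
  rw [← Finset.card_product]
  refine Finset.card_le_card_of_injOn
    (fun y => ((y (i 0), y (i 1)), (y (i 2), y (i 3)))) ?_ ?_
  · intro y hy
    simp only [coe_filter, mem_univ, true_and, Set.mem_ofPred_eq] at hy
    simpa using hq y hy
  · intro y _ z _ h
    simp only [Prod.mk.injEq] at h
    obtain ⟨⟨h0, h1⟩, h2, h3⟩ := h
    have hs : Function.Surjective i := Finite.surjective_of_injective hi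
    ext j
    obtain ⟨l, rfl⟩ := hs j
    fin_cases l
    · exact h0
    · exact h1
    · exact h2
    · exact h3

theorem card_embedding_two_le (q : (Fin 2 ↪ Y) → Prop) [DecidablePred q] (S : Finset (Y × Y))
    (hq : ∀ y, q y → (y 0, y 1) ∈ S) : #{y | q y} ≤ #S := by
  refine Finset.card_le_card_of_injOn (fun y => (y 0, y 1)) ?_ ?_
  · intro y hy
    simp only [coe_filter, mem_univ, true_and, Set.mem_ofPred_eq] at hy
    exact hq y hy
  · intro y _ z _ h
    simp only [Prod.mk.injEq] at h
    ext j
    fin_cases j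
    · exact h.1
    · exact h.2

/-- The relations between the roles `y 0`, …, `y 3` on the 4-cycle of `IsFourCycle`, together with
the condition that both communities on it have at most `K` roles. -/
def ClosesCycle (g : Y → A) (K : ℕ) (y : Fin 4 ↪ Y) : Prop :=
  g (y 0) = g (y 2) ∧ g (y 1) = g (y 3) ∧ fiberCard g (y 0) ≤ K ∧ fiberCard g (y 1) ≤ K

theorem card_closesCycle_le (g : Y → A) (K : ℕ) :
    #{y | ClosesCycle g K y} ≤ (Fintype.card Y * K) * (Fintype.card Y * K) := by
  refine (card_embedding_four_le ![0, 2, 1, 3] (by decide) _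
    {z : Y × Y | g z.1 = g z.2 ∧ fiberCard g z.1 ≤ K}
    {z : Y × Y | g z.1 = g z.2 ∧ fiberCard g z.1 ≤ K} ?_).trans
    (Nat.mul_le_mul (card_smallPairs_le g K) (card_smallPairs_le g K))
  rintro y ⟨h1, h2, h3, h4⟩
  simp [h1, h2] at h3 h4 ⊢
  exact ⟨h3, h4⟩

/-- One of the two elements of the pair lies in a fibre with more than `K` elements. -/
def MeetsLarge (g : Y → A) (K : ℕ) (y : Fin 2 ↪ Y) : Prop :=
  K < fiberCard g (y 0) ∨ K < fiberCard g (y 1)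

/-- The pair of roles does not join two distinct communities of size at most `K`. -/
def IsExceptional (g : Y → A) (K : ℕ) (y : Fin 2 ↪ Y) : Prop :=
  MeetsLarge g K y ∨ g (y 0) = g (y 1)

theorem card_meetsLarge_le (g : Y → A) (K : ℕ) :
    #{y : Fin 2 ↪ Y | MeetsLarge g K y} ≤
      2 * numLarge g K * Fintype.card Y := by
  refine (card_embedding_two_le _ (({y | K < fiberCard g y} : Finset Y) ×ˢ univ ∪
    univ ×ˢ ({y | K < fiberCard g y} : Finset Y)) ?_).trans ?_
  · intro y hy
    simpa [MeetsLarge] using hy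
  · refine (card_union_le _ _).trans (le_of_eq ?_)
    rw [card_product, card_product, card_univ, numLarge]
    ring

theorem card_isExceptional_le (g : Y → A) (K : ℕ) :
    #{y : Fin 2 ↪ Y | IsExceptional g K y} ≤
      2 * numLarge g K * Fintype.card Y + Fintype.card Y * K := by
  have hsub : ({y : Fin 2 ↪ Y | IsExceptional g K y} : Finset _) ⊆
      ({y : Fin 2 ↪ Y | MeetsLarge g K y} : Finset _) ∪
      ({y : Fin 2 ↪ Y | g (y 0) = g (y 1) ∧ fiberCard g (y 0) ≤ K} : Finset _) := by
    intro y hy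
    simp only [mem_union, mem_filter, mem_univ, true_and, IsExceptional, MeetsLarge] at hy ⊢
    grind
  refine (card_le_card hsub).trans ((card_union_le _ _).trans
    (add_le_add (card_meetsLarge_le g K) ?_))
  exact (card_embedding_two_le _ {z : Y × Y | g z.1 = g z.2 ∧ fiberCard g z.1 ≤ K}
    (fun y hy => by simpa using hy)).trans (card_smallPairs_le g K)

/-- The number of ordered pairs of distinct elements in the same fibre of `f`. -/
def numPairs (f : X → V) : ℕ := #{x : Fin 2 ↪ X | f (x 0) = f (x 1)}

theorem numPairs_le (f : X → V) (K : ℕ) :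
    numPairs f ≤ Fintype.card X * K + numLarge f K * Fintype.card X := by
  refine (card_embedding_two_le _ (({z : X × X | f z.1 = f z.2 ∧ fiberCard f z.1 ≤ K} : Finset _) ∪
    ({x | K < fiberCard f x} : Finset X) ×ˢ univ) ?_).trans ((card_union_le _ _).trans
    (add_le_add (card_smallPairs_le f K) ?_))
  · intro x hx
    by_cases hK : fiberCard f (x 0) ≤ K
    · simp [hx, hK]
    · simp [not_le.1 hK]
  · rw [card_product, numLarge, card_univ]

end Fibers

/-! ### Tuples under a uniform bijection -/

section UniformMatching

variable {X Y V A : Type*}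

/-- The tokens `x 0`, …, `x 3` are the edges of a 4-cycle in the bipartite incidence graph of
individuals and communities given by the bijection `ω`: the edges `x 0`, `x 1` start at one
individual, `x 2`, `x 3` at another, `x 0`, `x 2` end in one community, `x 1`, `x 3` in another. -/
def IsFourCycle (f : X → V) (g : Y → A) (ω : X ≃ Y) (x : Fin 4 → X) : Prop :=
  f (x 0) = f (x 1) ∧ f (x 2) = f (x 3) ∧ f (x 0) ≠ f (x 2) ∧
    g (ω (x 0)) = g (ω (x 2)) ∧ g (ω (x 1)) = g (ω (x 3)) ∧ g (ω (x 0)) ≠ g (ω (x 1))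

theorem IsFourCycle.injective {f : X → V} {g : Y → A} {ω : X ≃ Y} {x : Fin 4 → X}
    (h : IsFourCycle f g ω x) : Function.Injective x := by
  obtain ⟨h1, h2, h3, h4, h5, h6⟩ := h
  have h01 : x 0 ≠ x 1 := fun h => h6 (by rw [h])
  have h02 : x 0 ≠ x 2 := fun h => h3 (by rw [h])
  have h03 : x 0 ≠ x 3 := fun h => h3 (by rw [h, h2])
  have h12 : x 1 ≠ x 2 := fun h => h3 (by rw [h1, h])
  have h13 : x 1 ≠ x 3 := fun h => h3 (by rw [h1, h, h2])
  have h23 : x 2 ≠ x 3 := fun h => h6 (by rw [h4, h, h5])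
  intro i j hij
  fin_cases i <;> fin_cases j <;> first | rfl | (exfalso; simp at hij; grind)

variable [Fintype X] [Fintype Y]

/-- The points of `V` that lie on a 4-cycle. -/
def cycleVertices [Fintype V] (f : X → V) (g : Y → A) (ω : X ≃ Y) : Finset V :=
  {v | ∃ x : Fin 4 → X, IsFourCycle f g ω x ∧ f (x 0) = v}

/-- Points of `V` on a 4-cycle that meets a large fibre are few for every `ω`: each role, as well as
each token, belongs to one point of `V`, and a community with at most `K` roles contains at most
`K` points of `V`. -/
theorem card_cycleVertices_le [Fintype V] (f : X → V) (g : Y → A) (ω : X ≃ Y) (K L : ℕ) :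
    #(cycleVertices f g ω) ≤ numLarge g K + numLarge f L + K * numLarge f L +
      #{x : Fin 4 ↪ X | (f (x 0) = f (x 1) ∧ f (x 2) = f (x 3) ∧ fiberCard f (x 0) ≤ L ∧
        fiberCard f (x 2) ≤ L) ∧ ClosesCycle g K (x.trans ω.toEmbedding)} := by
  set S := ({x : Fin 4 ↪ X | (f (x 0) = f (x 1) ∧ f (x 2) = f (x 3) ∧ fiberCard f (x 0) ≤ L ∧
        fiberCard f (x 2) ≤ L) ∧ ClosesCycle g K (x.trans ω.toEmbedding)} : Finset _) with hS
  set S1 := ({y | K < fiberCard g y} : Finset Y).image (fun y => f (ω.symm y)) with hS1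
  set S2 := ({x | L < fiberCard f x} : Finset X).image f with hS2
  set S3 := ({x | L < fiberCard f x ∧ fiberCard g (ω x) ≤ K} : Finset X).biUnion
    (fun x => ({z | g z = g (ω x)} : Finset Y).image (fun y => f (ω.symm y))) with hS3
  have hsub : cycleVertices f g ω ⊆ S1 ∪ S2 ∪ S3 ∪ S.image (fun x => f (x 0)) := by
    intro v hv
    simp only [cycleVertices, mem_filter, mem_univ, true_and] at hv
    obtain ⟨x, hx, rfl⟩ := hv
    have hinj := hx.injective
    obtain ⟨h1, h2, h3, h4, h5, h6⟩ := hx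
    by_cases hg0 : K < fiberCard g (ω (x 0))
    · have : f (x 0) ∈ S1 := mem_image.2 ⟨ω (x 0), by simpa using hg0, by simp⟩
      simp [this]
    by_cases hg1 : K < fiberCard g (ω (x 1))
    · have : f (x 0) ∈ S1 := mem_image.2 ⟨ω (x 1), by simpa using hg1, by simp [h1]⟩
      simp [this]
    by_cases hf0 : L < fiberCard f (x 0)
    · have : f (x 0) ∈ S2 := mem_image.2 ⟨x 0, by simpa using hf0, rfl⟩
      simp [this]
    by_cases hf2 : L < fiberCard f (x 2)
    · have : f (x 0) ∈ S3 := mem_biUnion.2 ⟨x 2,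
        by simpa [hf2, ← fiberCard_congr h4] using hg0,
        mem_image.2 ⟨ω (x 0), by simpa using h4, by simp⟩⟩
      simp [this]
    · have : f (x 0) ∈ S.image (fun x => f (x 0)) := mem_image.2 ⟨⟨x, hinj⟩, by
        simp only [hS, mem_filter, mem_univ, true_and]
        exact ⟨⟨h1, h2, not_lt.1 hf0, not_lt.1 hf2⟩, h4, h5, not_lt.1 hg0, not_lt.1 hg1⟩, rfl⟩
      exact mem_union_right _ this
  refine (card_le_card hsub).trans ((card_union_le _ _).trans (add_le_add
    ((card_union_le _ _).trans (add_le_add ((card_union_le _ _).trans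
      (add_le_add card_image_le card_image_le)) ?_)) card_image_le))
  refine card_biUnion_le.trans ((Finset.sum_le_card_nsmul _ _ K ?_).trans ?_)
  · intro x hx
    simp only [mem_filter, mem_univ, true_and] at hx
    exact card_image_le.trans hx.2
  · rw [smul_eq_mul, mul_comm]
    refine Nat.mul_le_mul_left _ (card_le_card fun x hx => ?_)
    simp only [mem_filter, mem_univ, true_and] at hx ⊢
    exact hx.1

/-- The pair of communities is recovered from the two edges `x 0`, `x 1` alone. This is used for a
4-cycle with a community of more than `K` roles; otherwise all four edges are counted. -/
theorem card_le_of_fourCycles (f : X → V) (g : Y → A) (ω : X ≃ Y) (K : ℕ) (E : Finset (Sym2 A))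
    (hE : ∀ e ∈ E, ∃ x : Fin 4 → X, IsFourCycle f g ω x ∧ e = s(g (ω (x 0)), g (ω (x 1)))) :
    #E ≤ #{x : Fin 2 ↪ X | f (x 0) = f (x 1) ∧ MeetsLarge g K (x.trans ω.toEmbedding)} +
      #{x : Fin 4 ↪ X | (f (x 0) = f (x 1) ∧ f (x 2) = f (x 3)) ∧
        ClosesCycle g K (x.trans ω.toEmbedding)} := by
  set S := ({x : Fin 2 ↪ X | f (x 0) = f (x 1) ∧
    MeetsLarge g K (x.trans ω.toEmbedding)} : Finset _) with hS
  set T := ({x : Fin 4 ↪ X | (f (x 0) = f (x 1) ∧ f (x 2) = f (x 3)) ∧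
        ClosesCycle g K (x.trans ω.toEmbedding)} : Finset _) with hT
  have hsub : E ⊆ S.image (fun x => s(g (ω (x 0)), g (ω (x 1)))) ∪
      T.image (fun x => s(g (ω (x 0)), g (ω (x 1)))) := by
    intro e he
    obtain ⟨x, hx, rfl⟩ := hE e he
    have hinj := hx.injective
    obtain ⟨h1, h2, h3, h4, h5, h6⟩ := hx
    by_cases hK : K < fiberCard g (ω (x 0)) ∨ K < fiberCard g (ω (x 1))
    · refine mem_union_left _ (mem_image.2
        ⟨(⟨![0, 1], by decide⟩ : Fin 2 ↪ Fin 4).trans ⟨x, hinj⟩, ?_, rfl⟩)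
      simp only [hS, mem_filter, mem_univ, true_and]
      exact ⟨h1, hK⟩
    · push Not at hK
      refine mem_union_right _ (mem_image.2 ⟨⟨x, hinj⟩, ?_, rfl⟩)
      simp only [hT, mem_filter, mem_univ, true_and]
      exact ⟨⟨h1, h2⟩, h4, h5, hK.1, hK.2⟩
  exact (card_le_card hsub).trans ((card_union_le _ _).trans
    (add_le_add card_image_le card_image_le))

/-- Two communities of size at most `K` have at most `2 K` roles together, hence account for at most
`4 K ^ 2` ordered pairs of roles. -/
theorem numPairs_le_of_overlaps (f : X → V) (g : Y → A) (ω : X ≃ Y) (K : ℕ) (E : Finset (Sym2 A))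
    (hE : ∀ x₀ x₁, f x₀ = f x₁ → g (ω x₀) ≠ g (ω x₁) → s(g (ω x₀), g (ω x₁)) ∈ E) :
    numPairs f ≤ 4 * K ^ 2 * #E +
      #{x : Fin 2 ↪ X | f (x 0) = f (x 1) ∧ IsExceptional g K (x.trans ω.toEmbedding)} := by
  set S := ({x : Fin 2 ↪ X | f (x 0) = f (x 1)} : Finset _) with hS
  have hsplit := Finset.card_filter_add_card_filter_not (s := S)
    (fun x => IsExceptional g K (x.trans ω.toEmbedding))
  rw [hS, filter_filter, ← hS] at hsplit
  change #S ≤ _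
  rw [← hsplit, add_comm]
  refine Nat.add_le_add_right ?_ _
  have hmaps : ∀ x ∈ ({x ∈ S | ¬ IsExceptional g K (x.trans ω.toEmbedding)} : Finset _),
      s(g (ω (x 0)), g (ω (x 1))) ∈ E := by
    intro x hx
    simp only [hS, mem_filter, mem_univ, true_and, IsExceptional, MeetsLarge, not_or] at hx
    exact hE _ _ hx.1 hx.2.2
  refine Finset.card_le_mul_card_image_of_maps_to hmaps _ ?_
  intro e he
  induction e using Sym2.ind with
  | _ a b =>
  set F := ({x ∈ ({x ∈ S | ¬ IsExceptional g K (x.trans ω.toEmbedding)} : Finset _) |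
    s(g (ω (x 0)), g (ω (x 1))) = s(a, b)} : Finset _) with hF
  rcases F.eq_empty_or_nonempty with h0 | ⟨x₀, hx₀⟩
  · rw [h0]; simp
  -- Both roles of a pair over `s(a, b)` belong to `R`, the roles of `a` and of `b`.
  set R := ({y | g y = a} : Finset Y) ∪ ({y | g y = b} : Finset Y) with hR
  have hRc : #R ≤ 2 * K := by
    simp only [hF, hS, mem_filter, mem_univ, true_and, IsExceptional, MeetsLarge, not_or, not_lt,
      Function.Embedding.trans_apply, Equiv.coe_toEmbedding] at hx₀
    obtain ⟨⟨-, ⟨hk0, hk1⟩, -⟩, he⟩ := hx₀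
    refine (card_union_le _ _).trans ?_
    unfold fiberCard at hk0 hk1
    rcases Sym2.eq_iff.1 he with ⟨rfl, rfl⟩ | ⟨rfl, rfl⟩ <;> omega
  have : #F ≤ #(R ×ˢ R) := by
    refine Finset.card_le_card_of_injOn (fun x => (ω (x 0), ω (x 1))) ?_ ?_
    · intro x hx
      simp only [hF, coe_filter, mem_filter, Set.mem_ofPred_eq] at hx
      rcases Sym2.eq_iff.1 hx.2 with ⟨h1, h2⟩ | ⟨h1, h2⟩ <;> simp [hR, h1, h2]
    · intro x _ z _ h
      simp only [Prod.mk.injEq, EmbeddingLike.apply_eq_iff_eq] at h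
      ext j
      fin_cases j
      · exact h.1
      · exact h.2
  rw [card_product] at this
  calc #F ≤ #R * #R := this
    _ ≤ (2 * K) * (2 * K) := Nat.mul_le_mul hRc hRc
    _ = 4 * K ^ 2 := by ring

/-- Markov weight for the event that the ratio of `#E₂` to `#E₁` exceeds `ε`: either at least half
of the pairs counted by `numPairs f` are exceptional, or `#E₁` is at least `numPairs f / (8 K ^ 2)`. -/
theorem one_le_of_mul_card_lt (f : X → V) (g : Y → A) (ω : X ≃ Y) (K : ℕ) (E₁ E₂ : Finset (Sym2 A))
    (hE₁ : ∀ x₀ x₁, f x₀ = f x₁ → g (ω x₀) ≠ g (ω x₁) → s(g (ω x₀), g (ω x₁)) ∈ E₁)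
    (hE₂ : ∀ e ∈ E₂, ∃ x : Fin 4 → X, IsFourCycle f g ω x ∧ e = s(g (ω (x 0)), g (ω (x 1))))
    {ε : ℝ} (hε : 0 < ε) (h : ε * #E₁ < #E₂) :
    1 ≤ (#{x : Fin 2 ↪ X | f (x 0) = f (x 1) ∧
        IsExceptional g K (x.trans ω.toEmbedding)} : ℝ) * (2 / numPairs f) +
      #E₂ * (8 * K ^ 2 / (ε * numPairs f)) := by
  have hlow : (numPairs f : ℝ) ≤ 4 * K ^ 2 * #E₁ + (#{x : Fin 2 ↪ X | f (x 0) = f (x 1) ∧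
      IsExceptional g K (x.trans ω.toEmbedding)} : ℝ) := by
    exact_mod_cast numPairs_le_of_overlaps f g ω K E₁ hE₁
  set B := (#{x : Fin 2 ↪ X | f (x 0) = f (x 1) ∧
    IsExceptional g K (x.trans ω.toEmbedding)} : ℝ) with hB
  have hB0 : 0 ≤ B := Nat.cast_nonneg _
  have hD : (0 : ℝ) < numPairs f := by
    have hne : (0 : ℝ) < #E₂ := lt_of_le_of_lt (by positivity) h
    obtain ⟨e, he⟩ := Finset.card_pos.1 (Nat.cast_pos.1 hne)
    obtain ⟨x, hx, -⟩ := hE₂ e he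
    refine Nat.cast_pos.2 (Finset.card_pos.2
      ⟨(⟨![0, 1], by decide⟩ : Fin 2 ↪ Fin 4).trans ⟨x, hx.injective⟩, ?_⟩)
    simpa using hx.1
  by_cases hcase : numPairs f ≤ 2 * B
  · have h1 : 1 ≤ B * (2 / numPairs f) := by
      rw [mul_div_assoc', le_div_iff₀ hD]; linarith
    have h2 : 0 ≤ #E₂ * (8 * K ^ 2 / (ε * numPairs f)) := by positivity
    linarith
  · have h1 : 0 ≤ B * (2 / numPairs f) := by positivity
    have h2 : 1 ≤ #E₂ * (8 * K ^ 2 / (ε * numPairs f)) := by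
      rw [mul_div_assoc', le_div_iff₀ (by positivity)]
      have h3 : (8 * K ^ 2 : ℝ) * (ε * #E₁) ≤ 8 * K ^ 2 * #E₂ := by gcongr
      have h4 : ε * numPairs f ≤ ε * (8 * K ^ 2 * #E₁) :=
        mul_le_mul_of_nonneg_left (by linarith) hε.le
      linarith
    linarith

variable [DecidableEq X] [DecidableEq Y]

/-- A uniform bijection sends a given injective `k`-tuple to each injective `k`-tuple with the same
probability, because the permutations of `Y` act transitively on injective tuples. -/
theorem card_filter_trans_eq_mul_descFactorial {k : ℕ} (x : Fin k ↪ X) (y : Fin k ↪ Y) :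
    #{ω : X ≃ Y | x.trans ω.toEmbedding = y} * (Fintype.card Y).descFactorial k =
      Fintype.card (X ≃ Y) := by
  have key : ∀ y' : Fin k ↪ Y, #{ω : X ≃ Y | x.trans ω.toEmbedding = y'} =
      #{ω : X ≃ Y | x.trans ω.toEmbedding = y} := by
    intro y'
    obtain ⟨σ, hσ⟩ := (Equiv.Perm.isMultiplyPretransitive Y k).exists_smul_eq y' y
    have hσ' : ∀ i, σ (y' i) = y i := fun i => by
      rw [← hσ]; rfl
    refine Finset.card_bij (fun ω _ => ω.trans σ) ?_ ?_ ?_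
    · intro ω hω
      simp only [mem_filter, mem_univ, true_and] at hω ⊢
      ext i
      have := DFunLike.congr_fun hω i
      simp only [Function.Embedding.trans_apply, Equiv.coe_toEmbedding] at this
      simp [this, hσ']
    · intro ω _ ω' _ h
      ext z
      simpa using Equiv.congr_fun h z
    · intro ω hω
      simp only [mem_filter, mem_univ, true_and] at hω ⊢
      refine ⟨ω.trans σ.symm, ?_, ?_⟩
      · ext i
        have := DFunLike.congr_fun hω i
        simp only [Function.Embedding.trans_apply, Equiv.coe_toEmbedding] at this
        simp [this, Equiv.symm_apply_eq, hσ']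
      · ext z; simp
  have h := Finset.card_eq_sum_card_fiberwise (s := (univ : Finset (X ≃ Y)))
    (t := (univ : Finset (Fin k ↪ Y))) (f := fun ω => x.trans ω.toEmbedding) (by simp)
  rw [Finset.card_univ] at h
  rw [h, Finset.sum_congr rfl (fun y' _ => key y'), Finset.sum_const, smul_eq_mul, mul_comm,
    Finset.card_univ, Fintype.card_embedding_eq, Fintype.card_fin]

theorem expect_card_filter_trans [Nonempty (X ≃ Y)] {k : ℕ} (hk : k ≤ Fintype.card Y)
    (p : (Fin k ↪ X) → Prop) (q : (Fin k ↪ Y) → Prop) [DecidablePred p] [DecidablePred q] :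
    𝔼 ω : X ≃ Y, (#{x | p x ∧ q (x.trans ω.toEmbedding)} : ℝ) =
      #{x | p x} * #{y | q y} / (Fintype.card Y).descFactorial k := by
  have hd : ((Fintype.card Y).descFactorial k : ℝ) ≠ 0 := by
    exact_mod_cast (Nat.descFactorial_pos.2 hk).ne'
  have hc : (Fintype.card (X ≃ Y) : ℝ) ≠ 0 := by exact_mod_cast Fintype.card_ne_zero
  have hsum : ∑ ω : X ≃ Y, #{x | p x ∧ q (x.trans ω.toEmbedding)} =
      ∑ x with p x, ∑ y with q y, #{ω : X ≃ Y | x.trans ω.toEmbedding = y} := by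
    simp_rw [← filter_filter, Finset.card_filter]
    rw [Finset.sum_comm]
    refine Finset.sum_congr rfl fun x _ => ?_
    rw [Finset.sum_comm]
    refine Finset.sum_congr rfl fun ω _ => ?_
    rw [Finset.sum_ite_eq]
    simp
  rw [Fintype.expect_eq_sum_div_card, ← Nat.cast_sum, hsum, Nat.cast_sum,
    div_eq_div_iff hc hd]
  push_cast
  rw [Finset.sum_mul]
  simp_rw [Finset.sum_mul]
  have : ∀ x : Fin k ↪ X, ∀ y : Fin k ↪ Y,
      (#{ω : X ≃ Y | x.trans ω.toEmbedding = y} : ℝ) * (Fintype.card Y).descFactorial k =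
        Fintype.card (X ≃ Y) := fun x y => by
    exact_mod_cast card_filter_trans_eq_mul_descFactorial x y
  simp_rw [this]
  simp [mul_assoc]

/-- The descending factorial `h (h - 1) ⋯ (h - k + 1)` is at least `(h / 2) ^ k` when `2 k ≤ h`. -/
theorem expect_card_filter_trans_le [Nonempty (X ≃ Y)] {k : ℕ} (hk : 2 * k ≤ Fintype.card Y)
    (p : (Fin k ↪ X) → Prop) (q : (Fin k ↪ Y) → Prop) [DecidablePred p] [DecidablePred q]
    {a b : ℝ} (ha : #{x | p x} ≤ a)
    (hb : #{y | q y} ≤ b) :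
    𝔼 ω : X ≃ Y, (#{x | p x ∧ q (x.trans ω.toEmbedding)} : ℝ) ≤
      2 ^ k * a * b / (Fintype.card Y : ℝ) ^ k := by
  rw [expect_card_filter_trans (by omega)]
  set h := Fintype.card Y
  rcases Nat.eq_zero_or_pos h with h0 | hpos
  · obtain rfl : k = 0 := by omega
    simp only [Nat.descFactorial_zero, Nat.cast_one, div_one, pow_zero, one_mul]
    have : (0 : ℝ) ≤ a := le_trans (Nat.cast_nonneg _) ha
    gcongr
  have h1 : (h : ℝ) ^ k ≤ 2 ^ k * h.descFactorial k := by
    have : h ^ k ≤ 2 ^ k * h.descFactorial k := by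
      calc h ^ k ≤ (2 * (h + 1 - k)) ^ k := Nat.pow_le_pow_left (by omega) _
        _ = 2 ^ k * (h + 1 - k) ^ k := mul_pow _ _ _
        _ ≤ _ := Nat.mul_le_mul_left _ (Nat.pow_sub_le_descFactorial _ _)
    exact_mod_cast this
  have hd : (0 : ℝ) < h.descFactorial k := by
    exact_mod_cast Nat.descFactorial_pos.2 (by omega)
  have ha0 : (0 : ℝ) ≤ a := le_trans (Nat.cast_nonneg _) ha
  have hb0 : (0 : ℝ) ≤ b := le_trans (Nat.cast_nonneg _) hb
  have hh : (0 : ℝ) < (h : ℝ) ^ k := by positivity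
  rw [div_le_div_iff₀ hd hh]
  calc _ ≤ a * b * (2 ^ k * h.descFactorial k : ℝ) := by gcongr
    _ = _ := by ring

theorem expect_card_cycleVertices_le [Fintype V] [Nonempty (X ≃ Y)] (f : X → V) (g : Y → A)
    (hc : 8 ≤ Fintype.card Y) (K L : ℕ) :
    𝔼 ω : X ≃ Y, (#(cycleVertices f g ω) : ℝ) ≤
      numLarge g K + numLarge f L + K * numLarge f L + 16 * L ^ 2 * K ^ 2 := by
  have hXY : Fintype.card X = Fintype.card Y := Fintype.card_congr (Classical.arbitrary _)
  have hP : #{x : Fin 4 ↪ X | f (x 0) = f (x 1) ∧ f (x 2) = f (x 3) ∧ fiberCard f (x 0) ≤ L ∧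
        fiberCard f (x 2) ≤ L} ≤ (Fintype.card Y * L) * (Fintype.card Y * L) := by
    rw [← hXY]
    refine (card_embedding_four_le id Function.injective_id _
      {z : X × X | f z.1 = f z.2 ∧ fiberCard f z.1 ≤ L}
      {z : X × X | f z.1 = f z.2 ∧ fiberCard f z.1 ≤ L} ?_).trans
      (Nat.mul_le_mul (card_smallPairs_le f L) (card_smallPairs_le f L))
    rintro y ⟨h1, h2, h3, h4⟩
    simp [h1, h2] at h3 h4 ⊢
    exact ⟨h3, h4⟩
  have hT := expect_card_filter_trans_le (X := X) (Y := Y) (k := 4) hc _ _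
    (Nat.cast_le (α := ℝ).2 hP) (Nat.cast_le (α := ℝ).2 (card_closesCycle_le g K))
  have hh : (0 : ℝ) < Fintype.card Y := by exact_mod_cast (by omega : 0 < Fintype.card Y)
  calc 𝔼 ω : X ≃ Y, (#(cycleVertices f g ω) : ℝ)
      ≤ 𝔼 ω : X ≃ Y, ((numLarge g K + numLarge f L + K * numLarge f L : ℝ) +
      #{x : Fin 4 ↪ X | (f (x 0) = f (x 1) ∧ f (x 2) = f (x 3) ∧ fiberCard f (x 0) ≤ L ∧
        fiberCard f (x 2) ≤ L) ∧ ClosesCycle g K (x.trans ω.toEmbedding)}) := by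
        refine Finset.expect_le_expect fun ω _ => ?_
        exact_mod_cast card_cycleVertices_le f g ω K L
    _ ≤ _ := by
        rw [Finset.expect_add_distrib, Fintype.expect_const]
        gcongr
        refine hT.trans (le_of_eq ?_)
        push_cast
        field_simp
        ring

/-- The bound is small compared with `numPairs f` as soon as `numPairs f` is small compared with the
square of the number of tokens. -/
theorem expect_card_le_of_fourCycles [Nonempty (X ≃ Y)] (f : X → V) (g : Y → A)
    (hc : 8 ≤ Fintype.card Y) (K : ℕ) (E : (X ≃ Y) → Finset (Sym2 A))
    (hE : ∀ ω, ∀ e ∈ E ω, ∃ x : Fin 4 → X, IsFourCycle f g ω x ∧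
      e = s(g (ω (x 0)), g (ω (x 1)))) :
    𝔼 ω : X ≃ Y, (#(E ω) : ℝ) ≤ 8 * numPairs f * (numLarge g K / Fintype.card Y) +
      16 * (numPairs f) ^ 2 * K ^ 2 / (Fintype.card Y) ^ 2 := by
  have hP : #{x : Fin 4 ↪ X | f (x 0) = f (x 1) ∧ f (x 2) = f (x 3)} ≤
      numPairs f * numPairs f := by
    set S := ({x : Fin 2 ↪ X | f (x 0) = f (x 1)} : Finset _).image (fun x => (x 0, x 1)) with hS
    have h : numPairs f = #S := by
      rw [hS, Finset.card_image_of_injective, numPairs]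
      intro y z h
      simp only [Prod.mk.injEq] at h
      ext j
      fin_cases j
      · exact h.1
      · exact h.2
    rw [h]
    refine card_embedding_four_le id Function.injective_id _ S S ?_
    rintro x ⟨h1, h2⟩
    have hx := x.injective
    constructor
    · refine mem_image.2 ⟨(⟨![0, 1], by decide⟩ : Fin 2 ↪ Fin 4).trans x, ?_, rfl⟩
      simpa using h1
    · refine mem_image.2 ⟨(⟨![2, 3], by decide⟩ : Fin 2 ↪ Fin 4).trans x, ?_, rfl⟩
      simpa using h2
  have hT := expect_card_filter_trans_le (X := X) (Y := Y) (k := 4) hc _ _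
    (Nat.cast_le (α := ℝ).2 hP) (Nat.cast_le (α := ℝ).2 (card_closesCycle_le g K))
  have hU := expect_card_filter_trans_le (X := X) (Y := Y) (k := 2) (by omega)
    (fun x => f (x 0) = f (x 1)) _ (le_refl (numPairs f : ℝ))
    (Nat.cast_le (α := ℝ).2 (card_meetsLarge_le g K))
  have hh : (0 : ℝ) < Fintype.card Y := by exact_mod_cast (by omega : 0 < Fintype.card Y)
  refine (Finset.expect_le_expect fun ω _ =>
    Nat.cast_le.2 (card_le_of_fourCycles f g ω K (E ω) (hE ω))).trans ?_
  simp only [Nat.cast_add]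
  rw [Finset.expect_add_distrib]
  refine add_le_add (hU.trans (le_of_eq ?_)) (hT.trans (le_of_eq ?_))
  · push_cast
    field_simp
    ring
  · push_cast
    field_simp
    ring

theorem expect_card_isExceptional_le [Nonempty (X ≃ Y)] (f : X → V) (g : Y → A)
    (hc : 8 ≤ Fintype.card Y) (K : ℕ) :
    𝔼 ω : X ≃ Y, (#{x : Fin 2 ↪ X | f (x 0) = f (x 1) ∧
        IsExceptional g K (x.trans ω.toEmbedding)} : ℝ) ≤
      numPairs f * (8 * (numLarge g K / Fintype.card Y) + 4 * K / Fintype.card Y) := by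
  have hU := expect_card_filter_trans_le (X := X) (Y := Y) (k := 2) (by omega)
    (fun x => f (x 0) = f (x 1)) _ (le_refl (numPairs f : ℝ))
    (Nat.cast_le (α := ℝ).2 (card_isExceptional_le g K))
  have hh : (0 : ℝ) < Fintype.card Y := by exact_mod_cast (by omega : 0 < Fintype.card Y)
  refine hU.trans (le_of_eq ?_)
  push_cast
  field_simp
  ring

end UniformMatching

/-! ### Asymptotics under light tails -/

section Asymptotics

variable {X Y : ℕ → Type} {V A : ℕ → Type*} [∀ n, Fintype (X n)] [∀ n, Fintype (Y n)]

/-- Uniform integrability of the fibre sizes of the maps `f n`: fibres with more than `K` elements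
carry a proportion of the elements that is small uniformly in (large) `n`, if `K` is large. -/
def HasLightTails (f : ∀ n, X n → V n) : Prop :=
  ∀ τ : ℝ, 0 < τ → ∃ K : ℕ, ∀ᶠ n in atTop, (numLarge (f n) K : ℝ) ≤ τ * Fintype.card (X n)

theorem eventually_numPairs_le (f : ∀ n, X n → V n) (hf : HasLightTails f)
    (hX : Tendsto (fun n => Fintype.card (X n)) atTop atTop) {τ : ℝ} (hτ : 0 < τ) :
    ∀ᶠ n in atTop, (numPairs (f n) : ℝ) ≤ τ * (Fintype.card (X n) : ℝ) ^ 2 := by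
  obtain ⟨K, hK⟩ := hf (τ / 2) (by positivity)
  have hX' := (tendsto_natCast_atTop_atTop (R := ℝ)).comp hX
  filter_upwards [hK, hX'.eventually_ge_atTop (K * 2 / τ)] with n hK hb
  simp only [Function.comp_apply] at hb
  rw [div_le_iff₀ hτ] at hb
  have h : (numPairs (f n) : ℝ) ≤
      Fintype.card (X n) * K + numLarge (f n) K * Fintype.card (X n) := by
    exact_mod_cast numPairs_le (f n) K
  have h0 : (0 : ℝ) ≤ Fintype.card (X n) := Nat.cast_nonneg _
  nlinarith

variable [∀ n, DecidableEq (X n)] [∀ n, DecidableEq (Y n)] [∀ n, Nonempty (X n ≃ Y n)]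

theorem eventually_expect_card_cycleVertices_le [∀ n, Fintype (V n)] (f : ∀ n, X n → V n)
    (g : ∀ n, Y n → A n) (hf : HasLightTails f) (hg : HasLightTails g)
    (hY : Tendsto (fun n => Fintype.card (Y n)) atTop atTop) {τ : ℝ} (hτ : 0 < τ) :
    ∀ᶠ n in atTop, 𝔼 ω : X n ≃ Y n, (#(cycleVertices (f n) (g n) ω) : ℝ) ≤
      τ * Fintype.card (Y n) := by
  -- `L` depends on `K`, because tokens in large fibres enter with the weight `K + 1`.
  obtain ⟨K, hK⟩ := hg (τ / 3) (by positivity)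
  obtain ⟨L, hL⟩ := hf (τ / (3 * (K + 1))) (by positivity)
  have hY' := (tendsto_natCast_atTop_atTop (R := ℝ)).comp hY
  filter_upwards [hK, hL, hY.eventually_ge_atTop 8,
    hY'.eventually_ge_atTop (16 * (L : ℝ) ^ 2 * K ^ 2 * 3 / τ)] with n hK hL h8 hb
  have hXY : Fintype.card (X n) = Fintype.card (Y n) :=
    Fintype.card_congr (Classical.arbitrary (X n ≃ Y n))
  refine (expect_card_cycleVertices_le (f n) (g n) h8 K L).trans ?_
  rw [hXY] at hL
  simp only [Function.comp_apply] at hb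
  rw [div_le_iff₀ hτ] at hb
  have h2 : (K + 1 : ℝ) * numLarge (f n) L ≤ τ / 3 * Fintype.card (Y n) := by
    calc (K + 1 : ℝ) * numLarge (f n) L
        ≤ (K + 1 : ℝ) * (τ / (3 * (K + 1)) * Fintype.card (Y n)) := by gcongr
      _ = _ := by field_simp
  linarith

/-- The overlapping pairs `E₁` are at least of the order of `numPairs`, and the multiply overlapping
pairs `E₂` are of smaller order. No lower bound on `numPairs` is needed, since both are measured in
units of `numPairs`. -/
theorem eventually_exists_expect_le (f : ∀ n, X n → V n)
    (g : ∀ n, Y n → A n) (hf : HasLightTails f) (hg : HasLightTails g)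
    (hY : Tendsto (fun n => Fintype.card (Y n)) atTop atTop)
    (E₁ E₂ : ∀ n, (X n ≃ Y n) → Finset (Sym2 (A n)))
    (hE₁ : ∀ n ω x₀ x₁, f n x₀ = f n x₁ → g n (ω x₀) ≠ g n (ω x₁) →
      s(g n (ω x₀), g n (ω x₁)) ∈ E₁ n ω)
    (hE₂ : ∀ n ω, ∀ e ∈ E₂ n ω, ∃ x : Fin 4 → X n, IsFourCycle (f n) (g n) ω x ∧
      e = s(g n (ω (x 0)), g n (ω (x 1))))
    {ε δ : ℝ} (hε : 0 < ε) (hδ : 0 < δ) :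
    ∀ᶠ n in atTop, ∃ F : (X n ≃ Y n) → ℝ, (∀ ω, 0 ≤ F ω) ∧
      (∀ ω, ε * #(E₁ n ω) < #(E₂ n ω) → 1 ≤ F ω) ∧ 𝔼 ω, F ω ≤ δ := by
  have hXY : ∀ n, Fintype.card (X n) = Fintype.card (Y n) := fun n =>
    Fintype.card_congr (Classical.arbitrary (X n ≃ Y n))
  -- `K` controls the exceptional pairs; `L` is chosen after `K`, since the cycles are weighted by
  -- `8 * K ^ 2`.
  obtain ⟨K, hK⟩ := hg (δ / 64) (by positivity)
  obtain ⟨L, hL⟩ := hg (δ * ε / (4 * (64 * (K ^ 2 + 1)))) (by positivity)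
  have hD := eventually_numPairs_le f hf (by simpa only [hXY] using hY)
    (τ := δ * ε / (4 * (128 * (K ^ 2 * L ^ 2 + 1)))) (by positivity)
  have hY' := (tendsto_natCast_atTop_atTop (R := ℝ)).comp hY
  filter_upwards [hK, hL, hD, hY.eventually_ge_atTop 8,
    hY'.eventually_ge_atTop (8 * (K : ℝ) * 4 / δ)] with n hK hL hD h8 hb
  have hh : (0 : ℝ) < Fintype.card (Y n) := by exact_mod_cast (by omega : 0 < Fintype.card (Y n))
  refine ⟨_, fun ω => ?_, fun ω hω => one_le_of_mul_card_lt (f n) (g n) ω K _ _ (hE₁ n ω) (hE₂ n ω)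
    hε hω, ?_⟩
  · positivity
  rw [Finset.expect_add_distrib, ← Finset.expect_mul, ← Finset.expect_mul]
  rcases Nat.eq_zero_or_pos (numPairs (f n)) with h0 | hpos
  · -- Both weights are divisions by zero here, hence zero.
    simp [h0, hδ.le]
  have hDp : (0 : ℝ) < numPairs (f n) := Nat.cast_pos.2 hpos
  simp only [Function.comp_apply] at hb
  rw [hXY] at hD
  set h := (Fintype.card (Y n) : ℝ) with hdef
  set D := (numPairs (f n) : ℝ) with hDdef
  have e1 := expect_card_isExceptional_le (f n) (g n) h8 K
  have e2 := expect_card_le_of_fourCycles (f n) (g n) h8 L (E₂ n) (hE₂ n)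
  rw [← hdef, ← hDdef] at e1 e2
  have t1 : (numLarge (g n) K : ℝ) / h ≤ δ / 64 := (div_le_iff₀ hh).2 hK
  have t2 : (numLarge (g n) L : ℝ) / h ≤ δ * ε / (4 * (64 * (K ^ 2 + 1))) := (div_le_iff₀ hh).2 hL
  have t3 : 8 * K / h ≤ δ / 4 := by
    rw [div_le_iff₀ hδ] at hb
    rw [div_le_iff₀ hh]; linarith
  have t4 : D / h ^ 2 ≤ δ * ε / (4 * (128 * (K ^ 2 * L ^ 2 + 1))) :=
    (div_le_iff₀ (by positivity)).2 hD
  have s1 : D * (8 * (numLarge (g n) K / h) + 4 * K / h) * (2 / D) ≤ δ / 2 := by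
    have : D * (8 * (numLarge (g n) K / h) + 4 * K / h) * (2 / D) =
        16 * (numLarge (g n) K / h) + 8 * K / h := by field_simp; ring
    linarith
  have s2 : (8 * D * (numLarge (g n) L / h) + 16 * D ^ 2 * L ^ 2 / h ^ 2) *
      (8 * K ^ 2 / (ε * D)) ≤ δ / 2 := by
    have : (8 * D * (numLarge (g n) L / h) + 16 * D ^ 2 * L ^ 2 / h ^ 2) *
      (8 * K ^ 2 / (ε * D)) = 64 * K ^ 2 / ε * (numLarge (g n) L / h) +
        128 * (K ^ 2 * L ^ 2) / ε * (D / h ^ 2) := by field_simp; ring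
    rw [this]
    have u1 : 64 * K ^ 2 / ε * (numLarge (g n) L / h) ≤ δ / 4 := by
      calc 64 * K ^ 2 / ε * (numLarge (g n) L / h)
          ≤ 64 * (K ^ 2 + 1) / ε * (δ * ε / (4 * (64 * (K ^ 2 + 1)))) := by
            gcongr; linarith
        _ = δ / 4 := by field_simp
    have u2 : 128 * (K ^ 2 * L ^ 2) / ε * (D / h ^ 2) ≤ δ / 4 := by
      calc 128 * (K ^ 2 * L ^ 2) / ε * (D / h ^ 2)
          ≤ 128 * (K ^ 2 * L ^ 2 + 1) / ε * (δ * ε / (4 * (128 * (K ^ 2 * L ^ 2 + 1)))) := by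
            gcongr; linarith
        _ = δ / 4 := by field_simp
    linarith
  have r1 := mul_le_mul_of_nonneg_right e1 (by positivity : 0 ≤ 2 / D)
  have r2 := mul_le_mul_of_nonneg_right e2 (by positivity : 0 ≤ 8 * (K : ℝ) ^ 2 / (ε * D))
  linarith

end Asymptotics

/-! ### Light tails from convergence of the mean -/

section Tails

theorem fiberCard_sigma_fst {m : ℕ} (d : Fin m → ℕ) (x : Σ v, Fin (d v)) :
    fiberCard (Sigma.fst : (Σ v, Fin (d v)) → Fin m) x = d x.1 := by
  have : fiberCard (Sigma.fst : (Σ v, Fin (d v)) → Fin m) x =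
      #(({x.1} : Finset (Fin m)).sigma fun v => (univ : Finset (Fin (d v)))) := by
    rw [fiberCard]
    congr 1
    ext z
    simp
  rw [this, card_sigma]
  simp

theorem numLarge_sigma_fst {m : ℕ} (d : Fin m → ℕ) (K : ℕ) :
    numLarge (Sigma.fst : (Σ v, Fin (d v)) → Fin m) K = ∑ v with K < d v, d v := by
  have : ({z | K < d z.1} : Finset (Σ v, Fin (d v))) = ({v | K < d v} : Finset (Fin m)).sigma
      (fun _ => univ) := by
    ext z; simp
  simp only [numLarge, fiberCard_sigma_fst]
  rw [this, card_sigma]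
  simp

/-- If the empirical laws converge pointwise and the means converge to the mean of the limit, then
no mass of the mean escapes to infinity: subtract the truncated means, which are finite sums. -/
theorem exists_eventually_tail_le (m : ℕ → ℕ) (d : ∀ n, Fin (m n) → ℕ) (q : ℕ → ℝ)
    (hfreq : ∀ k, Tendsto (fun n => (({v | d n v = k} : Set (Fin (m n))).ncard : ℝ) / m n) atTop
      (𝓝 (q k)))
    (hsum : Summable fun k : ℕ => (k : ℝ) * q k)
    (hmean : Tendsto (fun n => (∑ v, (d n v : ℝ)) / m n) atTop (𝓝 (∑' k : ℕ, (k : ℝ) * q k)))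
    {τ : ℝ} (hτ : 0 < τ) :
    ∃ K : ℕ, ∀ᶠ n in atTop, ((∑ v with K < d n v, d n v : ℕ) : ℝ) ≤ τ * m n := by
  obtain ⟨K, hK⟩ := ((hsum.hasSum.tendsto_sum_nat.eventually_const_lt
    (sub_lt_self _ hτ)).and (eventually_ge_atTop 1)).exists
  -- The values `0, …, K - 1` are those that are not greater than `K - 1`, as `1 ≤ K`.
  refine ⟨K - 1, ?_⟩
  have hlim : Tendsto (fun n => (∑ v, (d n v : ℝ)) / m n - ∑ k ∈ range K, (k : ℝ) *
      ((({v | d n v = k} : Set (Fin (m n))).ncard : ℝ) / m n)) atTop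
      (𝓝 ((∑' k : ℕ, (k : ℝ) * q k) - ∑ k ∈ range K, (k : ℝ) * q k)) :=
    hmean.sub (tendsto_finsetSum _ fun k _ => (hfreq k).const_mul _)
  filter_upwards [hlim.eventually_lt_const (by linarith [hK.1] : _ < τ)] with n hn
  rcases Nat.eq_zero_or_pos (m n) with h0 | hpos
  · have : IsEmpty (Fin (m n)) := by rw [h0]; infer_instance
    simp [h0]
  have hm : (0 : ℝ) < m n := Nat.cast_pos.2 hpos
  have hsplit : ∑ k ∈ range K, k * ({v | d n v = k} : Set (Fin (m n))).ncard =
      ∑ v with ¬ K - 1 < d n v, d n v := by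
    rw [← Finset.sum_fiberwise_of_maps_to (t := range K) (g := d n)]
    · refine Finset.sum_congr rfl fun k hk => ?_
      rw [Finset.sum_congr rfl (g := fun _ => k) (fun v hv => (mem_filter.1 hv).2), sum_const,
        smul_eq_mul, mul_comm, Set.ncard_eq_toFinset_card']
      congr 2
      ext v
      simp only [Set.mem_toFinset, Set.mem_ofPred_eq, mem_filter, mem_univ, true_and]
      simp only [mem_range] at hk
      omega
    · intro v hv
      simp only [mem_filter, mem_univ, true_and, mem_range] at hv ⊢
      omega
  have htot := Finset.sum_filter_add_sum_filter_not (univ : Finset (Fin (m n)))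
    (fun v => K - 1 < d n v) (d n)
  rw [← hsplit] at htot
  have htot' : ((∑ v with K - 1 < d n v, d n v : ℕ) : ℝ) + ∑ k ∈ range K, (k : ℝ) *
      (({v | d n v = k} : Set (Fin (m n))).ncard : ℝ) = ∑ v, (d n v : ℝ) := by
    exact_mod_cast htot
  have hn' : (((∑ v with K - 1 < d n v, d n v : ℕ) : ℝ)) / m n < τ := by
    refine lt_of_eq_of_lt ?_ hn
    rw [← htot', add_div, Finset.sum_div]
    simp only [mul_div_assoc]
    ring
  exact ((div_lt_iff₀ hm).1 hn').le

end Tails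

/-! ### Overlaps and 4-cycles in the random intersection graph -/

namespace Params

variable {𝓗 : Set LabeledGraph} {P : Params 𝓗}

instance : DiscreteMeasurableSpace P.Matching := ⟨fun _ => trivial⟩

instance : DiscreteMeasurableSpace (Sym2 (Fin P.M)) := ⟨fun _ => trivial⟩

instance : Nonempty P.Matching := by
  refine Fintype.card_eq.1 ?_
  rw [Fintype.card_sigma, Fintype.card_sigma]
  simp only [Fintype.card_fin]
  exact P.halfEdges_eq

theorem card_LHalfEdge (P : Params 𝓗) : Fintype.card P.LHalfEdge = ∑ v, P.ldeg v := by simp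

theorem card_RHalfEdge (P : Params 𝓗) : Fintype.card P.RHalfEdge = ∑ v, P.rdeg v := by simp

theorem card_LHalfEdge_eq (P : Params 𝓗) :
    Fintype.card P.LHalfEdge = Fintype.card P.RHalfEdge :=
  Fintype.card_congr (Classical.arbitrary P.Matching)

theorem N_le_card (P : Params 𝓗) : P.N ≤ Fintype.card P.LHalfEdge := by
  rw [card_LHalfEdge]
  calc P.N = ∑ _v : Fin P.N, 1 := by simp
    _ ≤ _ := Finset.sum_le_sum fun v _ => P.ldeg_pos v

theorem rdeg_pos (h𝓗 : IsCommunityClass 𝓗) (a : Fin P.M) : 1 ≤ P.rdeg a := by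
  obtain ⟨i⟩ := (h𝓗.connected _ (P.com a).2).nonempty
  exact i.pos

theorem M_le_card (h𝓗 : IsCommunityClass 𝓗) (P : Params 𝓗) :
    P.M ≤ Fintype.card P.RHalfEdge := by
  rw [card_RHalfEdge]
  calc P.M = ∑ _a : Fin P.M, 1 := by simp
    _ ≤ _ := Finset.sum_le_sum fun a _ => rdeg_pos h𝓗 a

theorem isPartOf_iff {ω : P.Matching} {v : Fin P.N} {a : Fin P.M} :
    IsPartOf ω v a ↔ ∃ x : P.LHalfEdge, x.1 = v ∧ (ω x).1 = a := by
  constructor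
  · rintro ⟨l, hl⟩
    exact ⟨ω.symm ⟨a, l⟩, hl, by simp⟩
  · rintro ⟨x, hx, rfl⟩
    exact ⟨(ω x).2, by simp [Takes, hx]⟩

theorem overlap_comm (ω : P.Matching) (a b : Fin P.M) : overlap ω a b = overlap ω b a := by
  simp only [overlap, and_comm]

theorem mk_mem_overlapPairs {ω : P.Matching} {k : ℕ} {a b : Fin P.M} :
    s(a, b) ∈ overlapPairs ω k ↔ a ≠ b ∧ k ≤ overlap ω a b := by
  constructor
  · rintro ⟨a', b', he, hne, hk⟩
    rcases Sym2.eq_iff.1 he with ⟨rfl, rfl⟩ | ⟨rfl, rfl⟩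
    · exact ⟨hne, hk⟩
    · exact ⟨hne.symm, by rwa [overlap_comm]⟩
  · rintro ⟨hne, hk⟩
    exact ⟨a, b, rfl, hne, hk⟩

theorem exists_isFourCycle {ω : P.Matching} {v w : Fin P.N} {a b : Fin P.M} (hvw : v ≠ w)
    (hab : a ≠ b) (hva : IsPartOf ω v a) (hvb : IsPartOf ω v b) (hwa : IsPartOf ω w a)
    (hwb : IsPartOf ω w b) :
    ∃ x : Fin 4 → P.LHalfEdge, IsFourCycle Sigma.fst Sigma.fst ω x ∧ (x 0).1 = v ∧
      (ω (x 0)).1 = a ∧ (ω (x 1)).1 = b := by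
  obtain ⟨x₀, h0, h0'⟩ := isPartOf_iff.1 hva
  obtain ⟨x₁, h1, h1'⟩ := isPartOf_iff.1 hvb
  obtain ⟨x₂, h2, h2'⟩ := isPartOf_iff.1 hwa
  obtain ⟨x₃, h3, h3'⟩ := isPartOf_iff.1 hwb
  exact ⟨![x₀, x₁, x₂, x₃], by simp [IsFourCycle, *], by simp [*], by simp [*], by simp [*]⟩

theorem exists_ne_of_two_le_overlap {ω : P.Matching} {a b : Fin P.M} (h : 2 ≤ overlap ω a b)
    (v : Fin P.N) : ∃ w, w ≠ v ∧ IsPartOf ω w a ∧ IsPartOf ω w b := by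
  obtain ⟨w, hw, hne⟩ := Set.exists_ne_of_one_lt_ncard h v
  exact ⟨w, hne, hw⟩

theorem exists_two_of_two_le_overlap {ω : P.Matching} {a b : Fin P.M} (h : 2 ≤ overlap ω a b) :
    ∃ v w, v ≠ w ∧ (IsPartOf ω v a ∧ IsPartOf ω v b) ∧ IsPartOf ω w a ∧ IsPartOf ω w b := by
  obtain ⟨v, hv⟩ := Set.nonempty_of_ncard_ne_zero (s := {v | IsPartOf ω v a ∧ IsPartOf ω v b})
    (by change overlap ω a b ≠ 0; omega)
  obtain ⟨w, hne, hw⟩ := exists_ne_of_two_le_overlap h v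
  exact ⟨v, w, hne.symm, hv, hw⟩

theorem uniformOn_real_apply {Ω : Type*} [MeasurableSpace Ω] [MeasurableSingletonClass Ω]
    [Finite Ω] (s t : Set Ω) : (uniformOn s).real t = ((s ∩ t).ncard : ℝ) / s.ncard := by
  have := Fintype.ofFinite Ω
  have h := uniformOn_apply_finset (s := s.toFinset) (t := t.toFinset)
  simp only [Set.coe_toFinset] at h
  rw [Measure.real, h, ← Set.toFinset_inter, ← Set.ncard_eq_toFinset_card',
    ← Set.ncard_eq_toFinset_card']
  simp

theorem vertexOverlapProb_le (ω : P.Matching) : |vertexOverlapProb ω| ≤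
    (#(cycleVertices (Sigma.fst : P.LHalfEdge → Fin P.N)
      (Sigma.fst : P.RHalfEdge → Fin P.M) ω) : ℝ) / P.N := by
  rw [vertexOverlapProb, abs_of_nonneg measureReal_nonneg, individualLaw, uniformOn_real_apply,
    Set.univ_inter, Set.ncard_univ, Nat.card_eq_fintype_card, Fintype.card_fin]
  gcongr
  rw [← Set.ncard_coe_finset]
  refine Set.ncard_le_ncard ?_ (Finset.finite_toSet _)
  rintro v ⟨a, b, hab, hva, hvb⟩
  obtain ⟨hne, h2⟩ := mk_mem_overlapPairs.1 hab
  obtain ⟨w, hw, hwa, hwb⟩ := exists_ne_of_two_le_overlap h2 v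
  obtain ⟨x, hx, hxv, -⟩ := exists_isFourCycle hw.symm hne hva hvb hwa hwb
  simp only [cycleVertices, coe_filter, mem_univ, true_and, Set.mem_ofPred_eq]
  exact ⟨x, hx, hxv⟩

/-- For the inverse bijection, the communities are the points that `cycleVertices` counts. -/
theorem groupOverlapProb_le (ω : P.Matching) : |groupOverlapProb ω| ≤
    (#(cycleVertices (Sigma.fst : P.RHalfEdge → Fin P.M)
      (Sigma.fst : P.LHalfEdge → Fin P.N) ω.symm) : ℝ) / P.M := by
  rw [groupOverlapProb, abs_of_nonneg measureReal_nonneg, communityLaw, uniformOn_real_apply,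
    Set.univ_inter, Set.ncard_univ, Nat.card_eq_fintype_card, Fintype.card_fin]
  gcongr
  rw [← Set.ncard_coe_finset]
  refine Set.ncard_le_ncard ?_ (Finset.finite_toSet _)
  rintro a ⟨b, ⟨hba, -⟩, h2⟩
  obtain ⟨v, w, hvw, ⟨hva, hvb⟩, hwa, hwb⟩ := exists_two_of_two_le_overlap h2
  obtain ⟨x, ⟨h1, h2, h3, h4, h5, h6⟩, -, hxa, -⟩ :=
    exists_isFourCycle hvw hba.symm hva hvb hwa hwb
  simp only [cycleVertices, coe_filter, mem_univ, true_and, Set.mem_ofPred_eq]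
  exact ⟨![ω (x 0), ω (x 2), ω (x 1), ω (x 3)],
    ⟨h4, h5, h6, by simpa using h1, by simpa using h2, by simpa using h3⟩, hxa⟩

/-- If no two communities overlap, the left side is a value of the zero measure and the right side is
a division by zero, so both are zero. -/
theorem globalOverlapProb_eq (ω : P.Matching) :
    globalOverlapProb ω = ((overlapPairs ω 2).ncard : ℝ) / (overlapPairs ω 1).ncard := by
  rw [globalOverlapProb, uniformOn_real_apply]
  congr 3
  ext e
  constructor
  · rintro ⟨⟨a, b, rfl, hne, -⟩, a', b', he, h2⟩
    rw [he, mk_mem_overlapPairs]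
    refine ⟨?_, h2⟩
    rcases Sym2.eq_iff.1 he with ⟨rfl, rfl⟩ | ⟨rfl, rfl⟩
    · exact hne
    · exact hne.symm
  · rintro ⟨a, b, rfl, hne, h2⟩
    exact ⟨⟨a, b, rfl, hne, by omega⟩, a, b, rfl, h2⟩

theorem mk_mem_overlapPairs_one {ω : P.Matching} (x₀ x₁ : P.LHalfEdge) (h : x₀.1 = x₁.1)
    (hne : (ω x₀).1 ≠ (ω x₁).1) : s((ω x₀).1, (ω x₁).1) ∈ (overlapPairs ω 1).toFinset := by
  rw [Set.mem_toFinset, mk_mem_overlapPairs]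
  refine ⟨hne, Nat.one_le_iff_ne_zero.2 ?_⟩
  refine Set.ncard_ne_zero_of_mem (a := x₀.1) ?_
  exact ⟨isPartOf_iff.2 ⟨x₀, rfl, rfl⟩, isPartOf_iff.2 ⟨x₁, h.symm, rfl⟩⟩

theorem exists_isFourCycle_of_mem_overlapPairs_two {ω : P.Matching} (e : Sym2 (Fin P.M))
    (he : e ∈ (overlapPairs ω 2).toFinset) :
    ∃ x : Fin 4 → P.LHalfEdge, IsFourCycle Sigma.fst Sigma.fst ω x ∧
      e = s((ω (x 0)).1, (ω (x 1)).1) := by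
  obtain ⟨a, b, rfl, hne, h2⟩ := Set.mem_toFinset.1 he
  obtain ⟨v, w, hvw, ⟨hva, hvb⟩, hwa, hwb⟩ := exists_two_of_two_le_overlap h2
  obtain ⟨x, hx, -, hxa, hxb⟩ := exists_isFourCycle hvw hne hva hvb hwa hwb
  exact ⟨x, hx, by rw [hxa, hxb]⟩

theorem matchingLaw_real_le_expect (S : Set P.Matching) (F : P.Matching → ℝ) (h0 : ∀ ω, 0 ≤ F ω)
    (h1 : ∀ ω ∈ S, 1 ≤ F ω) : P.matchingLaw.real S ≤ 𝔼 ω, F ω := by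
  rw [matchingLaw, uniformOn_real_apply, Set.univ_inter, Set.ncard_univ, Nat.card_eq_fintype_card,
    Fintype.expect_eq_sum_div_card]
  gcongr
  rw [Set.ncard_eq_toFinset_card']
  calc (#S.toFinset : ℝ) = ∑ ω ∈ S.toFinset, 1 := by simp
    _ ≤ ∑ ω ∈ S.toFinset, F ω := Finset.sum_le_sum fun ω hω => h1 ω (Set.mem_toFinset.1 hω)
    _ ≤ ∑ ω, F ω := Finset.sum_le_sum_of_subset_of_nonneg (subset_univ _) fun ω _ _ => h0 ω

theorem sum_ncard_com_eq (P : Params 𝓗) (k : ℕ) (S : Finset 𝓗)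
    (hS : ∀ H, H ∈ S ↔ H.1.1 = k) :
    (({a | P.rdeg a = k} : Set (Fin P.M)).ncard : ℝ) / P.M = ∑ H ∈ S, P.comFreq H := by
  simp only [comFreq]
  rw [← Finset.sum_div]
  congr 1
  rw [← Nat.cast_sum, Set.ncard_eq_toFinset_card', Finset.card_eq_sum_card_fiberwise (f := P.com)
    (t := S)]
  · congr 1
    refine Finset.sum_congr rfl fun H hH => ?_
    rw [Set.ncard_eq_toFinset_card']
    congr 1
    ext a
    simp only [Set.mem_toFinset, Set.mem_ofPred_eq, mem_filter, and_iff_right_iff_imp]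
    rintro rfl
    exact (hS _).1 hH
  · intro a ha
    simp only [Set.coe_toFinset, Set.mem_ofPred_eq] at ha
    exact (hS _).2 ha

end Params

/-! ### Convergence in probability -/

open Params

variable {𝓗 : Set LabeledGraph}

theorem finite_setOf_size_eq (𝓗 : Set LabeledGraph) (k : ℕ) : {H : 𝓗 | H.1.1 = k}.Finite := by
  refine Set.Finite.of_finite_image (f := Subtype.val)
    ((Set.finite_range (fun G : SimpleGraph (Fin k) => (⟨k, G⟩ : LabeledGraph))).subset ?_)
    Subtype.val_injective.injOn
  rintro _ ⟨⟨⟨m, G⟩, hH⟩, rfl, rfl⟩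
  exact ⟨G, rfl⟩

theorem toReal_sizeLaw_eq_sum (μ : PMF 𝓗) (k : ℕ) (S : Finset 𝓗) (hS : ∀ H, H ∈ S ↔ H.1.1 = k) :
    (sizeLaw μ k).toReal = ∑ H ∈ S, (μ H).toReal := by
  rw [← ENNReal.toReal_sum fun H _ => μ.apply_ne_top H, sizeLaw, PMF.map_apply,
    tsum_eq_sum (s := S)]
  · congr 1
    refine Finset.sum_congr rfl fun H hH => ?_
    rw [if_pos ((hS H).1 hH).symm]
  · intro H hH
    rw [if_neg]
    exact fun h => hH ((hS H).2 h.symm)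

variable {P : ℕ → Params 𝓗} {p : PMF ℕ} {μ : PMF 𝓗}

theorem Converges.hasLightTails_ldeg (hP : Converges P p μ) :
    HasLightTails fun n => (Sigma.fst : (P n).LHalfEdge → Fin (P n).N) := by
  intro τ hτ
  obtain ⟨K, hK⟩ := exists_eventually_tail_le (fun n => (P n).N) (fun n => (P n).ldeg)
    (fun k => (p k).toReal) hP.ldeg_limit hP.ldeg_mean_finite hP.ldeg_mean hτ
  refine ⟨K, hK.mono fun n hn => ?_⟩
  rw [numLarge_sigma_fst]
  refine hn.trans ?_
  gcongr
  exact N_le_card _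

theorem Converges.hasLightTails_rdeg (h𝓗 : IsCommunityClass 𝓗) (hP : Converges P p μ) :
    HasLightTails fun n => (Sigma.fst : (P n).RHalfEdge → Fin (P n).M) := by
  intro τ hτ
  obtain ⟨K, hK⟩ := exists_eventually_tail_le (fun n => (P n).M) (fun n => (P n).rdeg)
    (fun k => (sizeLaw μ k).toReal) (fun k => by
      have hS : ∀ H, H ∈ (finite_setOf_size_eq 𝓗 k).toFinset ↔ H.1.1 = k := by simp
      simp only [sum_ncard_com_eq _ k _ hS, toReal_sizeLaw_eq_sum μ k _ hS]
      exact tendsto_finsetSum _ fun H _ => hP.com_limit H) hP.rdeg_mean_finite hP.rdeg_mean hτ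
  refine ⟨K, hK.mono fun n hn => ?_⟩
  rw [numLarge_sigma_fst]
  refine hn.trans ?_
  gcongr
  exact M_le_card h𝓗 _

theorem tendsto_card_RHalfEdge (hN : Tendsto (fun n => (P n).N) atTop atTop) :
    Tendsto (fun n => Fintype.card (P n).RHalfEdge) atTop atTop :=
  tendsto_atTop_mono (fun n => (N_le_card (P n)).trans_eq (card_LHalfEdge_eq _)) hN

/-- Markov's inequality, with a dominating function `F` that may depend on the tolerances. -/
theorem tendstoInProbZero_of_expect_le {X : ∀ n, (P n).Matching → ℝ}
    (h : ∀ ε : ℝ, 0 < ε → ∀ δ : ℝ, 0 < δ → ∀ᶠ n in atTop, ∃ F : (P n).Matching → ℝ,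
      (∀ ω, 0 ≤ F ω) ∧ (∀ ω, ε < |X n ω| → 1 ≤ F ω) ∧ 𝔼 ω, F ω ≤ δ) :
    TendstoInProbZero P X := by
  intro ε hε
  rw [Metric.tendsto_atTop']
  intro δ hδ
  obtain ⟨n₀, hn₀⟩ := eventually_atTop.1 (h ε hε (δ / 2) (by positivity))
  refine ⟨n₀, fun n hn => ?_⟩
  obtain ⟨F, hF0, hF1, hF⟩ := hn₀ n hn.le
  rw [Real.dist_0_eq_abs, abs_of_nonneg measureReal_nonneg]
  have := matchingLaw_real_le_expect {ω | ε < |X n ω|} F hF0 hF1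
  linarith

/-- First-moment criterion for a quantity that is at most a proportion `B n ω / m n`, where the mean
of `B n` is small compared with `c n` and `c n / m n` is bounded. -/
theorem tendstoInProbZero_of_proportion {X : ∀ n, (P n).Matching → ℝ}
    (B : ∀ n, (P n).Matching → ℕ) (c m : ℕ → ℕ) (C : ℝ) (hC : ∀ᶠ n in atTop, (c n : ℝ) / m n < C)
    (hX : ∀ n ω, |X n ω| ≤ (B n ω : ℝ) / m n)
    (hB : ∀ τ : ℝ, 0 < τ → ∀ᶠ n in atTop, 𝔼 ω, (B n ω : ℝ) ≤ τ * c n) :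
    TendstoInProbZero P X := by
  refine tendstoInProbZero_of_expect_le fun ε hε δ hδ => ?_
  have hC0 : 0 ≤ C := by
    obtain ⟨n, hn⟩ := hC.exists
    exact le_trans (by positivity) hn.le
  filter_upwards [hC, hB (δ * ε / (C + 1)) (by positivity)] with n hC hB
  refine ⟨fun ω => B n ω / (m n * ε), fun ω => by positivity, fun ω hω => ?_, ?_⟩
  · have := hω.trans_le (hX n ω)
    rcases Nat.eq_zero_or_pos (m n) with h0 | hpos
    · rw [h0] at this
      simp only [Nat.cast_zero, div_zero] at this
      exact absurd this hε.not_gt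
    · have hm : (0 : ℝ) < m n := Nat.cast_pos.2 hpos
      rw [lt_div_iff₀ hm] at this
      rw [le_div_iff₀ (by positivity)]
      linarith
  · rw [← Finset.expect_div]
    rcases Nat.eq_zero_or_pos (m n) with h0 | hpos
    · simp [h0, hδ.le]
    · have hm : (0 : ℝ) < m n := Nat.cast_pos.2 hpos
      rw [div_lt_iff₀ hm] at hC
      rw [div_le_iff₀ (by positivity)]
      refine hB.trans ?_
      rw [div_mul_eq_mul_div, div_le_iff₀ (by positivity)]
      have : (c n : ℝ) ≤ (C + 1) * m n := by linarith
      nlinarith [mul_le_mul_of_nonneg_left this (by positivity : 0 ≤ δ * ε)]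

theorem tendstoInProbZero_vertexOverlapProb (h𝓗 : IsCommunityClass 𝓗) (hP : Converges P p μ)
    (hN : Tendsto (fun n => (P n).N) atTop atTop) :
    TendstoInProbZero P (fun _ ω => vertexOverlapProb ω) := by
  have hl := hP.hasLightTails_ldeg
  have hr := hP.hasLightTails_rdeg h𝓗
  have hR := tendsto_card_RHalfEdge hN
  refine tendstoInProbZero_of_proportion _ (fun n => Fintype.card (P n).RHalfEdge)
    (fun n => (P n).N) ((∑' k : ℕ, (k : ℝ) * (p k).toReal) + 1)
    ((hP.ldeg_mean.eventually_lt_const (lt_add_one _)).mono fun n hn => ?_)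
    (fun n ω => vertexOverlapProb_le ω)
    (fun τ hτ => eventually_expect_card_cycleVertices_le _ _ hl hr hR hτ)
  rw [← card_LHalfEdge_eq, card_LHalfEdge]
  push_cast
  exact hn

theorem tendstoInProbZero_groupOverlapProb (h𝓗 : IsCommunityClass 𝓗) (hP : Converges P p μ)
    (hN : Tendsto (fun n => (P n).N) atTop atTop) :
    TendstoInProbZero P (fun _ ω => groupOverlapProb ω) := by
  have hl := hP.hasLightTails_ldeg
  have hr := hP.hasLightTails_rdeg h𝓗
  have hR := tendsto_card_RHalfEdge hN
  have hL : Tendsto (fun n => Fintype.card (P n).LHalfEdge) atTop atTop := by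
    simpa only [card_LHalfEdge_eq] using hR
  refine tendstoInProbZero_of_proportion _ (fun n => Fintype.card (P n).LHalfEdge)
    (fun n => (P n).M) ((∑' k : ℕ, (k : ℝ) * (sizeLaw μ k).toReal) + 1)
    ((hP.rdeg_mean.eventually_lt_const (lt_add_one _)).mono fun n hn => ?_)
    (fun n ω => groupOverlapProb_le ω)
    (fun τ hτ => ?_)
  · rw [card_LHalfEdge_eq, card_RHalfEdge]
    push_cast
    exact hn
  · have : ∀ n, Nonempty ((P n).RHalfEdge ≃ (P n).LHalfEdge) := fun n =>
      ⟨(Classical.arbitrary (P n).Matching).symm⟩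
    refine (eventually_expect_card_cycleVertices_le _ _ hr hl hL hτ).mono fun n hn => ?_
    refine le_of_eq_of_le ?_ hn
    exact Fintype.expect_equiv (Equiv.symmEquiv _ _) _ _ fun ω => rfl

theorem tendstoInProbZero_globalOverlapProb (h𝓗 : IsCommunityClass 𝓗) (hP : Converges P p μ)
    (hN : Tendsto (fun n => (P n).N) atTop atTop) :
    TendstoInProbZero P (fun _ ω => globalOverlapProb ω) := by
  have hl := hP.hasLightTails_ldeg
  have hr := hP.hasLightTails_rdeg h𝓗
  have hR := tendsto_card_RHalfEdge hN
  refine tendstoInProbZero_of_expect_le fun ε hε δ hδ => ?_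
  refine (eventually_exists_expect_le _ _ hl hr hR
    (fun n ω => (overlapPairs ω 1).toFinset) (fun n ω => (overlapPairs ω 2).toFinset)
    (fun n ω x₀ x₁ => mk_mem_overlapPairs_one x₀ x₁)
    (fun n ω e he => exists_isFourCycle_of_mem_overlapPairs_two e he) hε hδ).mono ?_
  rintro n ⟨F, hF0, hF1, hF⟩
  refine ⟨F, hF0, fun ω hω => hF1 ω ?_, hF⟩
  rw [globalOverlapProb_eq, abs_of_nonneg (by positivity), Set.ncard_eq_toFinset_card',
    Set.ncard_eq_toFinset_card'] at hω
  refine lt_of_not_ge fun hle => ?_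
  rcases Nat.eq_zero_or_pos #(overlapPairs ω 1).toFinset with h0 | hpos
  · rw [h0] at hω
    simp only [Nat.cast_zero, div_zero] at hω
    exact absurd hω hε.not_gt
  · rw [lt_div_iff₀ (Nat.cast_pos.2 hpos)] at hω
    exact absurd hω (not_lt.2 hle)

end RIGC

end

theorem theorem2p10 (𝓗 : Set RIGC.LabeledGraph) (h𝓗 : RIGC.IsCommunityClass 𝓗)
    (P : ℕ → RIGC.Params 𝓗) (hN : Tendsto (fun n => (P n).N) atTop atTop)
    (p : PMF ℕ) (μ : PMF 𝓗) (hP : RIGC.Converges P p μ) :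
    RIGC.TendstoInProbZero P (fun _ ω => RIGC.Params.vertexOverlapProb ω) ∧
    RIGC.TendstoInProbZero P (fun _ ω => RIGC.Params.groupOverlapProb ω) ∧
    (RIGC.SecondMomentConverges P p →
      (∀ (n : ℕ) (ω : (P n).Matching),
        RIGC.Params.globalOverlapProb ω =
          ((RIGC.Params.overlapPairs ω 2).ncard : ℝ) / (RIGC.Params.overlapPairs ω 1).ncard) ∧
      RIGC.TendstoInProbZero P (fun _ ω => RIGC.Params.globalOverlapProb ω)) :=
  ⟨RIGC.tendstoInProbZero_vertexOverlapProb h𝓗 hP hN,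
    RIGC.tendstoInProbZero_groupOverlapProb h𝓗 hP hN,
    fun _ => ⟨fun _ ω => RIGC.Params.globalOverlapProb_eq ω,
      RIGC.tendstoInProbZero_globalOverlapProb h𝓗 hP hN⟩⟩
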